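/- Let $E_8$ be the $E_8$ lattice, $O(E_8)$ its isometry group, and $A_4=\{x\in\mathbb Z^5 : \sum_k x_k=0\}$ with the standard dot product. A root of a lattice is a vector of norm $(r,r)=2$. Call $h\in O(E_8)$ rootless if $(h-1)E_8$ contains no roots. Let $h\in O(E_8)$ be rootless of order $5$. Then: (a) $h$ is fixed-point-free, i.e. $hx=x$ with $x\in E_8$ implies $x=0$; (b) $h$ is conjugate in $O(E_8)$ to $h_{A_4}\oplus h_{A_4}$. Precisely: $E_8$ contains a sublattice isometric to $A_4\perp A_4$; and for every isometric embedding $i: A_4\perp A_4\to E_8$ and all $5$-cycles $\sigma,\tau\in \mathrm{Sym}_5$, acting on the two copies of $A_4$ by permuting coordinates, the isometry $\sigma\oplus\tau$ of $i(A_4\perp A_4)$ extends to an isometry of $E_8$, and $h$ is conjugate in $O(E_8)$ to such an extension. -/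

import Mathlib

namespace Rootless

open LinearMap (BilinForm)

/-- The orthogonal group `O(L)` of a lattice `L`, given as a `ℤ`-module with a bilinear form `B`:
the group of `ℤ`-linear automorphisms of `L` that preserve `B`. -/
def orthogonalGroup {L : Type*} [AddCommGroup L] (B : BilinForm ℤ L) :
    Subgroup (L ≃ₗ[ℤ] L) where
  carrier := {f | ∀ x y, B (f x) (f y) = B x y}
  mul_mem' := by
    intro f g hf hg x y
    exact (hf (g x) (g y)).trans (hg x y)
  one_mem' := fun _ _ => rfl
  inv_mem' := by
    intro f hf x y
    have h := hf (f⁻¹ x) (f⁻¹ y)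
    have e : ∀ z, f (f⁻¹ z) = z := fun z => f.apply_symm_apply z
    rw [e, e] at h
    exact h.symm

/-- A root is a vector of norm `(r, r) = 2`. -/
def IsRoot {L : Type*} [AddCommGroup L] (B : BilinForm ℤ L) (r : L) : Prop :=
  B r r = 2

/-- `h ∈ O(L)` is rootless if `(h - 1)L` contains no roots. -/
def IsRootless {L : Type*} [AddCommGroup L] {B : BilinForm ℤ L} (h : orthogonalGroup B) : Prop :=
  ∀ x : L, ¬ IsRoot B (h.1 x - x)

/-- `h ∈ O(L)` is fixed-point-free if `0` is its only fixed vector. -/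
def IsFixedPointFree {L : Type*} [AddCommGroup L] {B : BilinForm ℤ L} (h : orthogonalGroup B) :
    Prop :=
  ∀ x : L, h.1 x = x → x = 0

/-- The form of the orthogonal sum `L ⊥ M` of two lattices:
`((x, y), (x', y')) = (x, x') + (y, y')`. -/
def sumForm {L M : Type*} [AddCommGroup L] [AddCommGroup M]
    (B : BilinForm ℤ L) (C : BilinForm ℤ M) : BilinForm ℤ (L × M) :=
  B.comp (LinearMap.fst ℤ L M) (LinearMap.fst ℤ L M) +
    C.comp (LinearMap.snd ℤ L M) (LinearMap.snd ℤ L M)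

/-- The isometry `f ⊕ g : (x, y) ↦ (f x, g y)` of `L ⊥ M`, for `f ∈ O(L)` and `g ∈ O(M)`. -/
def directSum {L M : Type*} [AddCommGroup L] [AddCommGroup M]
    {B : BilinForm ℤ L} {C : BilinForm ℤ M} (f : orthogonalGroup B) (g : orthogonalGroup C) :
    orthogonalGroup (sumForm B C) :=
  ⟨LinearEquiv.prodCongr f.1 g.1, fun x y => congrArg₂ (· + ·) (f.2 x.1 y.1) (g.2 x.2 y.2)⟩

/-- Given an isometric embedding `i : (L, B) → (M, C)`, the isometry `g` of `M` extends the
isometry `f` of `L`: the sublattice `i(L)` is stable under `g`, which acts on it as `f`. -/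
def Extends {L M : Type*} [AddCommGroup L] [AddCommGroup M]
    {B : BilinForm ℤ L} {C : BilinForm ℤ M} (i : B →bᵢ C)
    (g : orthogonalGroup C) (f : orthogonalGroup B) : Prop :=
  ∀ x : L, g.1 (i x) = i (f.1 x)

/-- The form of the `E₈` lattice: the lattice is `ℤ⁸`, its standard basis being a system of simple
roots, and the Gram matrix is the Cartan matrix of type `E₈`. -/
def formE8 : BilinForm ℤ (Fin 8 → ℤ) :=
  Matrix.toLinearMap₂' ℤ CartanMatrix.E₈

/-- The standard model of the lattice `A_n`: the vectors of `ℤⁿ⁺¹` with coordinate sum `0`. -/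
def latticeA (n : ℕ) : Submodule ℤ (Fin (n + 1) → ℤ) where
  carrier := {x | ∑ k, x k = 0}
  add_mem' := by
    intro x y hx hy
    change ∑ k, x k = 0 at hx
    change ∑ k, y k = 0 at hy
    change ∑ k, (x + y) k = 0
    simp [Finset.sum_add_distrib, hx, hy]
  zero_mem' := by simp
  smul_mem' := by
    intro c x hx
    change ∑ k, x k = 0 at hx
    change ∑ k, (c • x) k = 0
    simp [← Finset.mul_sum, hx]

/-- The form of `A_n`: the restriction of the standard dot product of `ℤⁿ⁺¹`. -/
def formA (n : ℕ) : BilinForm ℤ (latticeA n) :=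
  BilinForm.restrict (dotProductBilin ℤ ℤ) (latticeA n)

/-- The element of `O(A_n)` that permutes the coordinates by `σ`, so that `e_k ↦ e_{σ k}`. These
elements make up the Weyl group of `A_n`, which is the symmetric group on `n + 1` letters. -/
def permA {n : ℕ} (σ : Equiv.Perm (Fin (n + 1))) : orthogonalGroup (formA n) :=
  ⟨LinearEquiv.ofSubmodules (LinearEquiv.funCongrLeft ℤ ℤ σ.symm) (latticeA n) (latticeA n) (by
      have key : ∀ (ρ : Equiv.Perm (Fin (n + 1))) (x : Fin (n + 1) → ℤ),
          x ∈ latticeA n → x ∘ ρ ∈ latticeA n := fun ρ x hx => (Equiv.sum_comp ρ x).trans hx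
      ext y
      constructor
      · rintro ⟨x, hx, rfl⟩
        exact key σ.symm x hx
      · intro hy
        exact ⟨y ∘ σ, key σ y hy, funext fun k => congrArg y (σ.apply_symm_apply k)⟩),
    fun x y => Equiv.sum_comp σ.symm fun k => x.1 k * y.1 k⟩

/-- `σ` is an `(n + 1)`-cycle: a cycle that moves all the `n + 1` letters. -/
def IsFullCycle {n : ℕ} (σ : Equiv.Perm (Fin (n + 1))) : Prop :=
  σ.IsCycle ∧ σ.support = Finset.univ

end Rootless

namespace Rootless

open LinearMap (BilinForm)

/-! ### The form of the `E₈` lattice -/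

/-! Write `f` for `h`. Rootlessness forces `(r, f r)` and `(r, f² r)` into `{2, 0, -1}` for every
root `r`. If `r` is not fixed, the orbit sum has norm `5(2 + 2(r, f r) + 2(r, f² r)) ≥ 0`; five
orthogonal roots are impossible (`no_orthogonal_root_orbit`), so the norm is `0` and the orbit sum
vanishes. Fixed roots are orthogonal to such roots and the Dynkin diagram is connected, hence `f =
1` or `1 + f + f² + f³ + f⁴ = 0`. Order `5` leaves the latter, and then a fixed `x` has `5x = 0`.

Isometries satisfying this equation form one conjugacy class. They make `E₈` a module over `ℤ[ζ₅]`,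
and `exists_isStandardPair` finds roots `s`, `t` with prescribed products along their orbits. The
Gram matrix of these orbits has determinant a unit, so they give a basis, and matching two such
bases conjugates one isometry to the other (`IsCyclotomicFive.isConj`).

Finally `σ ⊕ τ` extends to `E₈` because permutations act trivially on the discriminant group of
`A₄`; the extension satisfies the same equation since `A₄ ⊥ A₄` has full rank (`exists_extends`). -/

theorem formE8_eq_dotProduct (x y : Fin 8 → ℤ) :
    formE8 x y = x ⬝ᵥ (CartanMatrix.E₈.mulVec y) := by
  simp [formE8, Matrix.toLinearMap₂'_apply']

theorem formE8_apply (x y : Fin 8 → ℤ) :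
    formE8 x y = 2 * (x 0 * y 0 + x 1 * y 1 + x 2 * y 2 + x 3 * y 3 + x 4 * y 4 + x 5 * y 5 +
      x 6 * y 6 + x 7 * y 7) - (x 0 * y 2 + x 2 * y 0) - (x 1 * y 3 + x 3 * y 1) -
      (x 2 * y 3 + x 3 * y 2) - (x 3 * y 4 + x 4 * y 3) - (x 4 * y 5 + x 5 * y 4) -
      (x 5 * y 6 + x 6 * y 5) - (x 6 * y 7 + x 7 * y 6) := by
  rw [formE8_eq_dotProduct]
  simp [CartanMatrix.E₈, Matrix.mulVec, dotProduct, Fin.sum_univ_eight]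
  ring

theorem formE8_comm (x y : Fin 8 → ℤ) : formE8 x y = formE8 y x := by
  rw [formE8_apply, formE8_apply]; ring

theorem formE8_single (j k : Fin 8) :
    formE8 (Pi.single j 1) (Pi.single k 1) = CartanMatrix.E₈ j k := by
  simp [formE8_eq_dotProduct]

theorem formE8_single_self (j : Fin 8) : formE8 (Pi.single j 1) (Pi.single j 1) = 2 := by
  simp [formE8_single]

theorem even_formE8_self (x : Fin 8 → ℤ) : ∃ m, formE8 x x = 2 * m := by
  refine ⟨x 0 * x 0 + x 1 * x 1 + x 2 * x 2 + x 3 * x 3 + x 4 * x 4 + x 5 * x 5 + x 6 * x 6 +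
    x 7 * x 7 - x 0 * x 2 - x 1 * x 3 - x 2 * x 3 - x 3 * x 4 - x 4 * x 5 - x 5 * x 6 -
    x 6 * x 7, ?_⟩
  rw [formE8_apply]; ring

/-- Completing squares along the Dynkin diagram gives positive definiteness; `60` clears the
denominators. -/
theorem sixty_mul_formE8_self (x : Fin 8 → ℤ) :
    60 * formE8 x x = 30 * (2 * x 0 - x 2) ^ 2 + 30 * (2 * x 1 - x 3) ^ 2 +
      10 * (3 * x 2 - 2 * x 3) ^ 2 + 2 * (5 * x 3 - 6 * x 4) ^ 2 + 3 * (4 * x 4 - 5 * x 5) ^ 2 +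
      5 * (3 * x 5 - 4 * x 6) ^ 2 + 10 * (2 * x 6 - 3 * x 7) ^ 2 + 30 * x 7 ^ 2 := by
  rw [formE8_apply]; ring

theorem formE8_self_nonneg (x : Fin 8 → ℤ) : 0 ≤ formE8 x x := by
  have h := sixty_mul_formE8_self x
  have : 0 ≤ 60 * formE8 x x := by rw [h]; positivity
  omega

theorem eq_zero_of_formE8_self_eq_zero {x : Fin 8 → ℤ} (hx : formE8 x x = 0) : x = 0 := by
  have h := sixty_mul_formE8_self x
  rw [hx] at h
  have h7 : x 7 = 0 := by
    by_contra hc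
    have : 0 < x 7 ^ 2 := by positivity
    have : 0 ≤ 30 * (2 * x 0 - x 2) ^ 2 + 30 * (2 * x 1 - x 3) ^ 2 +
      10 * (3 * x 2 - 2 * x 3) ^ 2 + 2 * (5 * x 3 - 6 * x 4) ^ 2 + 3 * (4 * x 4 - 5 * x 5) ^ 2 +
      5 * (3 * x 5 - 4 * x 6) ^ 2 + 10 * (2 * x 6 - 3 * x 7) ^ 2 := by positivity
    omega
  have n0 := sq_nonneg (2 * x 0 - x 2)
  have n1 := sq_nonneg (2 * x 1 - x 3)
  have n2 := sq_nonneg (3 * x 2 - 2 * x 3)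
  have n3 := sq_nonneg (5 * x 3 - 6 * x 4)
  have n4 := sq_nonneg (4 * x 4 - 5 * x 5)
  have n5 := sq_nonneg (3 * x 5 - 4 * x 6)
  have n6 := sq_nonneg (2 * x 6 - 3 * x 7)
  have n7 := sq_nonneg (x 7)
  have m0 := pow_eq_zero_iff two_ne_zero |>.mp (show (2 * x 0 - x 2) ^ 2 = 0 by omega)
  have m1 := pow_eq_zero_iff two_ne_zero |>.mp (show (2 * x 1 - x 3) ^ 2 = 0 by omega)
  have m2 := pow_eq_zero_iff two_ne_zero |>.mp (show (3 * x 2 - 2 * x 3) ^ 2 = 0 by omega)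
  have m3 := pow_eq_zero_iff two_ne_zero |>.mp (show (5 * x 3 - 6 * x 4) ^ 2 = 0 by omega)
  have m4 := pow_eq_zero_iff two_ne_zero |>.mp (show (4 * x 4 - 5 * x 5) ^ 2 = 0 by omega)
  have m5 := pow_eq_zero_iff two_ne_zero |>.mp (show (3 * x 5 - 4 * x 6) ^ 2 = 0 by omega)
  have m6 := pow_eq_zero_iff two_ne_zero |>.mp (show (2 * x 6 - 3 * x 7) ^ 2 = 0 by omega)
  ext i
  fin_cases i <;> simp <;> omega

/-- The dual basis of the simple roots exists in `E₈`: the lattice is unimodular. -/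
theorem exists_dual_formE8 (j : Fin 8) : ∃ z, ∀ x, formE8 z x = x j := by
  -- The matrix is the inverse of the Cartan matrix.
  refine ⟨(!![4, 5, 7, 10, 8, 6, 4, 2; 5, 8, 10, 15, 12, 9, 6, 3; 7, 10, 14, 20, 16, 12, 8, 4;
    10, 15, 20, 30, 24, 18, 12, 6; 8, 12, 16, 24, 20, 15, 10, 5; 6, 9, 12, 18, 15, 12, 8, 4;
    4, 6, 8, 12, 10, 8, 6, 3; 2, 3, 4, 6, 5, 4, 3, 2] : Matrix (Fin 8) (Fin 8) ℤ) j, fun x => ?_⟩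
  rw [formE8_apply]
  fin_cases j <;> simp <;> ring

theorem exists_eq_smul_of_dvd_formE8 {m : ℤ} {x : Fin 8 → ℤ} (hx : ∀ y, m ∣ formE8 y x) :
    ∃ z, x = m • z := by
  have : ∀ j, ∃ c, x j = m * c := fun j => by
    obtain ⟨z, hz⟩ := exists_dual_formE8 j
    rw [← hz x]
    exact hx z
  choose z hz using this
  exact ⟨z, funext hz⟩

/-- A submodule of `E₈` that contains the simple roots is everything. -/
theorem mem_of_single_mem {S : Submodule ℤ (Fin 8 → ℤ)}
    (hS : ∀ j, (Pi.single j 1 : Fin 8 → ℤ) ∈ S) (x : Fin 8 → ℤ) : x ∈ S := by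
  rw [pi_eq_sum_univ' x]
  refine S.sum_mem fun j _ => S.smul_mem _ ?_
  convert hS j using 1

theorem root_eq_of_formE8_eq_two {r s : Fin 8 → ℤ} (hr : formE8 r r = 2) (hs : formE8 s s = 2)
    (h : formE8 r s = 2) : s = r := by
  refine sub_eq_zero.mp (eq_zero_of_formE8_self_eq_zero ?_)
  have := formE8_comm r s
  simp only [map_sub, LinearMap.sub_apply]
  omega

theorem formE8_root_root_bounds {r s : Fin 8 → ℤ} (hr : formE8 r r = 2) (hs : formE8 s s = 2) :
    -2 ≤ formE8 r s ∧ formE8 r s ≤ 2 := by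
  have h1 := formE8_self_nonneg (r + s)
  have h2 := formE8_self_nonneg (r - s)
  have := formE8_comm r s
  simp only [map_sub, LinearMap.sub_apply, map_add, LinearMap.add_apply] at h1 h2
  omega

theorem root_eq_neg_of_formE8_eq_neg_two {r s : Fin 8 → ℤ} (hr : formE8 r r = 2)
    (hs : formE8 s s = 2) (h : formE8 r s = -2) : s = -r := by
  have := root_eq_of_formE8_eq_two hr (s := -s) (by simpa) (by simp [h])
  rw [← this, neg_neg]

/-! ### Rootless isometries of order 5 are fixed-point-free -/

theorem isUnit_det_E8_map_zmod : IsUnit (CartanMatrix.E₈.map (Int.cast : ℤ → ZMod 2)).det := by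
  have := Int.cast_det (R := ZMod 2) CartanMatrix.E₈
  rw [CartanMatrix.E₈_det] at this
  rw [← this]; simp

/-- The form of `E₈` modulo `2` is nondegenerate on a space of dimension `8`, so a totally
isotropic family of five vectors is linearly dependent modulo `2`. -/
theorem exists_sum_eq_two_smul_of_even {v : Fin 5 → Fin 8 → ℤ}
    (hv : ∀ i j, (2 : ℤ) ∣ formE8 (v i) (v j)) :
    ∃ n : Fin 5 → ℤ, (∀ i, n i = 0 ∨ n i = 1) ∧ (∃ i, n i ≠ 0) ∧
      ∃ w, ∑ i, n i • v i = (2 : ℤ) • w := by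
  let R : Matrix (Fin 5) (Fin 8) ℤ := Matrix.of v
  let R2 : Matrix (Fin 5) (Fin 8) (ZMod 2) := R.map (Int.cast : ℤ → ZMod 2)
  have hzero : R2 * (CartanMatrix.E₈.map (Int.cast : ℤ → ZMod 2) * R2.transpose) = 0 := by
    have : R2 * (CartanMatrix.E₈.map (Int.cast : ℤ → ZMod 2) * R2.transpose) =
        (R * (CartanMatrix.E₈ * R.transpose)).map (Int.cast : ℤ → ZMod 2) := by
      have e : ∀ {l m : Type} (M : Matrix l m ℤ),
          M.map (Int.cast : ℤ → ZMod 2) = M.map (Int.castRingHom (ZMod 2)) := fun _ => rfl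
      simp only [R2, e, Matrix.map_mul, Matrix.transpose_map]
    rw [this]
    ext i j
    have h := hv i j
    rw [formE8_eq_dotProduct] at h
    have e : (R * (CartanMatrix.E₈ * R.transpose)) i j =
        v i ⬝ᵥ CartanMatrix.E₈.mulVec (v j) := rfl
    simpa [e] using (ZMod.intCast_zmod_eq_zero_iff_dvd _ 2).mpr h
  -- Independent rows would give both factors of the zero product rank `5`, and `5 + 5 > 8`.
  have hdep : ¬ LinearIndependent (ZMod 2) R2.row := by
    intro hli
    have h1 := Matrix.rank_add_rank_le_card_of_mul_eq_zero hzero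
    rw [Matrix.rank_mul_eq_right_of_isUnit_det _ _ isUnit_det_E8_map_zmod,
      Matrix.rank_transpose, hli.rank_matrix] at h1
    simp at h1
  rw [Fintype.not_linearIndependent_iff] at hdep
  obtain ⟨g, hg, i, hi⟩ := hdep
  refine ⟨fun i => (g i).val, fun i => ?_, ⟨i, ?_⟩, ?_⟩
  · have := (g i).val_lt
    dsimp only
    omega
  · have : (g i).val ≠ 0 := (ZMod.val_ne_zero _).mpr hi
    dsimp only
    exact_mod_cast this
  · have : ∀ j, ∃ c, (∑ i, ((g i).val : ℤ) • v i) j = 2 * c := by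
      intro j
      have h := congrFun hg j
      refine (ZMod.intCast_zmod_eq_zero_iff_dvd _ 2).mp ?_
      simp only [Finset.sum_apply, Pi.smul_apply, smul_eq_mul, Int.cast_sum, Int.cast_mul,
        Int.cast_natCast, ZMod.natCast_zmod_val] at h ⊢
      exact h
    choose w hw using this
    exact ⟨w, funext hw⟩

theorem four_dvd_sum_sq {v : Fin 5 → Fin 8 → ℤ}
    (hv : ∀ i j, formE8 (v i) (v j) = if i = j then 2 else 0) {n : Fin 5 → ℤ} {w : Fin 8 → ℤ}
    (hw : ∑ i, n i • v i = (2 : ℤ) • w) : (4 : ℤ) ∣ ∑ i, n i ^ 2 := by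
  have h := congrArg (fun x => formE8 x x) hw
  obtain ⟨m, hm⟩ := even_formE8_self w
  simp only [map_sum, LinearMap.sum_apply, map_smul, LinearMap.smul_apply, smul_eq_mul, hv, hm,
    mul_ite, mul_zero, Finset.sum_ite_eq', Finset.mem_univ, if_true] at h
  have e : ∑ i, n i ^ 2 = ∑ i, n i * n i := by simp only [sq]
  refine ⟨m, ?_⟩
  rw [e]
  have : ∑ x, n x * (n x * 2) = 2 * ∑ i, n i * n i := by
    rw [Finset.mul_sum]; exact Finset.sum_congr rfl fun _ _ => by ring
  omega

/-- An isometry of `E₈` does not permute five pairwise orthogonal roots cyclically. -/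
theorem no_orthogonal_root_orbit {f : (Fin 8 → ℤ) →ₗ[ℤ] (Fin 8 → ℤ)}
    (hf : ∀ x y, formE8 (f x) (f y) = formE8 x y) {r : Fin 8 → ℤ}
    (h5 : f (f (f (f (f r)))) = r) (hr : formE8 r r = 2)
    (h1 : formE8 r (f r) = 0) (h2 : formE8 r (f (f r)) = 0) : False := by
  have h3 : formE8 r (f (f (f r))) = 0 := by
    rw [← hf, ← hf, h5, formE8_comm]; exact h2
  have h4 : formE8 r (f (f (f (f r)))) = 0 := by
    rw [← hf, h5, formE8_comm]; exact h1
  let v : Fin 5 → Fin 8 → ℤ := ![r, f r, f (f r), f (f (f r)), f (f (f (f r)))]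
  have hv : ∀ i j, formE8 (v i) (v j) = if i = j then 2 else 0 := by
    have c1 := formE8_comm (f r) r
    have c2 := formE8_comm (f (f r)) r
    have c3 := formE8_comm (f (f (f r))) r
    have c4 := formE8_comm (f (f (f (f r)))) r
    intro i j
    fin_cases i <;> fin_cases j <;> simp [v, hf, hr, h1, h2, h3, h4, c1, c2, c3, c4]
  obtain ⟨n, hn, ⟨i, hi⟩, w, hw⟩ := exists_sum_eq_two_smul_of_even (v := v) fun i j => by
    rw [hv]; split <;> simp
  have k1 := four_dvd_sum_sq hv hw
  -- `k1` forces exactly four of the `n i` to be `1`. Adding the relation to its image under `f`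
  -- then gives coefficients `1, 1, 2, 2, 2` in some order, whose squares sum to `14`, not divisible
  -- by `4`.
  have hw' : ∑ i, (![n 0 + n 4, n 1 + n 0, n 2 + n 1, n 3 + n 2, n 4 + n 3] : Fin 5 → ℤ) i • v i =
      (2 : ℤ) • (w + f w) := by
    have := congrArg f hw
    simp only [map_sum, map_smul] at this
    rw [smul_add, ← hw, ← this]
    simp only [Fin.sum_univ_five, v, Matrix.cons_val, h5]
    module
  have k2 := four_dvd_sum_sq hv hw'
  simp [Fin.sum_univ_five] at k1 k2
  have hi' : n 0 ≠ 0 ∨ n 1 ≠ 0 ∨ n 2 ≠ 0 ∨ n 3 ≠ 0 ∨ n 4 ≠ 0 := by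
    fin_cases i <;> simp_all
  rcases hn 0 with e0 | e0 <;> rcases hn 1 with e1 | e1 <;> rcases hn 2 with e2 | e2 <;>
    rcases hn 3 with e3 | e3 <;> rcases hn 4 with e4 | e4 <;>
    simp [e0, e1, e2, e3, e4] at k1 k2 hi'

/-- A root is either fixed by a rootless isometry of order dividing `5`, or its orbit has sum zero. -/
theorem fixed_or_orbit_sum_eq_zero {f : (Fin 8 → ℤ) →ₗ[ℤ] (Fin 8 → ℤ)}
    (hf : ∀ x y, formE8 (f x) (f y) = formE8 x y) (h5 : ∀ x, f (f (f (f (f x)))) = x)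
    (hroot : ∀ x, formE8 (f x - x) (f x - x) ≠ 2) {r : Fin 8 → ℤ} (hr : formE8 r r = 2) :
    f r = r ∨ r + f r + f (f r) + f (f (f r)) + f (f (f (f r))) = 0 := by
  have hr1 : formE8 (f r) (f r) = 2 := by rw [hf, hr]
  have hr2 : formE8 (f (f r)) (f (f r)) = 2 := by rw [hf, hr1]
  have b1 := formE8_root_root_bounds hr hr1
  have b2 := formE8_root_root_bounds hr hr2
  have n1 : formE8 r (f r) ≠ 1 := fun h => hroot r (by
    simp only [map_sub, LinearMap.sub_apply, hf]; rw [formE8_comm (f r) r, h, hr]; norm_num)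
  -- The telescoping `(f - 1)(f r + r) = f² r - r` puts this vector in the image of `f - 1`.
  have n2 : formE8 r (f (f r)) ≠ 1 := fun h => hroot (f r + r) (by
    simp only [map_sub, map_add, LinearMap.sub_apply, LinearMap.add_apply, hf]
    rw [formE8_comm (f r) r, formE8_comm (f (f r)) r, h, hr]; ring)
  have r0 : r ≠ 0 := by rintro rfl; simp at hr
  have m1 : formE8 r (f r) ≠ -2 := fun h => r0 (by
    have e := root_eq_neg_of_formE8_eq_neg_two hr hr1 h
    have := h5 r
    simp only [e, map_neg, neg_neg] at this
    exact self_eq_neg.mp this.symm)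
  have m2 : formE8 r (f (f r)) ≠ -2 := fun h => r0 (by
    have e := root_eq_neg_of_formE8_eq_neg_two hr hr2 h
    have h10 : f (f (f (f (f (f (f (f (f (f r))))))))) = r := by rw [h5, h5]
    simp only [e, map_neg, neg_neg] at h10
    exact self_eq_neg.mp h10.symm)
  by_cases p1 : formE8 r (f r) = 2
  · exact Or.inl (root_eq_of_formE8_eq_two hr hr1 p1)
  by_cases p2 : formE8 r (f (f r)) = 2
  · left
    have e := root_eq_of_formE8_eq_two hr hr2 p2
    have := h5 r
    rwa [e, e] at this
  right
  have h3 : formE8 r (f (f (f r))) = formE8 r (f (f r)) := by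
    rw [← hf, ← hf, h5, formE8_comm]
  have h4 : formE8 r (f (f (f (f r)))) = formE8 r (f r) := by
    rw [← hf, h5, formE8_comm]
  have hnorm : formE8 (r + f r + f (f r) + f (f (f r)) + f (f (f (f r))))
      (r + f r + f (f r) + f (f (f r)) + f (f (f (f r)))) =
      5 * (2 + 2 * formE8 r (f r) + 2 * formE8 r (f (f r))) := by
    simp only [map_add, LinearMap.add_apply, hf]
    rw [formE8_comm (f r) r, formE8_comm (f (f r)) r, formE8_comm (f (f (f r))) r,
      formE8_comm (f (f (f (f r)))) r, h3, h4, hr]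
    ring
  have hnn := formE8_self_nonneg (r + f r + f (f r) + f (f (f r)) + f (f (f (f r))))
  refine eq_zero_of_formE8_self_eq_zero ?_
  rw [hnorm] at hnn ⊢
  have : ¬ (formE8 r (f r) = 0 ∧ formE8 r (f (f r)) = 0) := fun h =>
    no_orthogonal_root_orbit hf (h5 r) hr h.1 h.2
  omega

/-- All `(x, fᵏ y)` equal `(x, y)`, so `5(x, y) = 0`. -/
theorem formE8_eq_zero_of_fixed {f : (Fin 8 → ℤ) →ₗ[ℤ] (Fin 8 → ℤ)}
    (hf : ∀ x y, formE8 (f x) (f y) = formE8 x y) {x y : Fin 8 → ℤ} (hx : f x = x)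
    (hy : y + f y + f (f y) + f (f (f y)) + f (f (f (f y))) = 0) : formE8 x y = 0 := by
  have k : ∀ z, formE8 x (f z) = formE8 x z := fun z => by
    conv_lhs => rw [← hx]
    exact hf x z
  have := congrArg (formE8 x) hy
  simp only [map_add, k, map_zero] at this
  omega

/-- A rootless isometry of `E₈` whose fifth power is trivial is trivial, or a primitive fifth root of
unity. -/
theorem eq_id_or_orbit_sum_eq_zero {f : (Fin 8 → ℤ) →ₗ[ℤ] (Fin 8 → ℤ)}
    (hf : ∀ x y, formE8 (f x) (f y) = formE8 x y) (h5 : ∀ x, f (f (f (f (f x)))) = x)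
    (hroot : ∀ x, formE8 (f x - x) (f x - x) ≠ 2) :
    (∀ x, f x = x) ∨ ∀ x, x + f x + f (f x) + f (f (f x)) + f (f (f (f x))) = 0 := by
  have key : ∀ j k : Fin 8, CartanMatrix.E₈ j k ≠ 0 →
      f (Pi.single j 1) = Pi.single j 1 → f (Pi.single k 1) = Pi.single k 1 := by
    intro j k hjk hj
    refine (fixed_or_orbit_sum_eq_zero hf h5 hroot (formE8_single_self k)).resolve_right fun h => ?_
    rw [← formE8_single] at hjk
    exact hjk (formE8_eq_zero_of_fixed hf hj h)
  have all : ∀ j, f (Pi.single j 1) = Pi.single j 1 → ∀ k, f (Pi.single k 1) = Pi.single k 1 := by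
    -- Being fixed spreads along edges of the Dynkin diagram: towards the branch node `3`, then
    -- outwards from it.
    have to3 : ∀ j, f (Pi.single j 1) = Pi.single j 1 → f (Pi.single 3 1) = Pi.single 3 1 := by
      intro j hj
      fin_cases j
      · exact key 2 3 (by decide) (key 0 2 (by decide) hj)
      · exact key 1 3 (by decide) hj
      · exact key 2 3 (by decide) hj
      · exact hj
      · exact key 4 3 (by decide) hj
      · exact key 4 3 (by decide) (key 5 4 (by decide) hj)
      · exact key 4 3 (by decide) (key 5 4 (by decide) (key 6 5 (by decide) hj))
      · exact key 4 3 (by decide) (key 5 4 (by decide) (key 6 5 (by decide)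
          (key 7 6 (by decide) hj)))
    intro j hj k
    have h3 := to3 j hj
    have h4 := key 3 4 (by decide) h3
    have h5 := key 4 5 (by decide) h4
    have h6 := key 5 6 (by decide) h5
    fin_cases k
    · exact key 2 0 (by decide) (key 3 2 (by decide) h3)
    · exact key 3 1 (by decide) h3
    · exact key 3 2 (by decide) h3
    · exact h3
    · exact h4
    · exact h5
    · exact h6
    · exact key 6 7 (by decide) h6
  by_cases hj : ∃ j, f (Pi.single j 1) = Pi.single j 1
  · obtain ⟨j, hj⟩ := hj
    left
    exact mem_of_single_mem (S := LinearMap.eqLocus f LinearMap.id) (all j hj)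
  · push Not at hj
    right
    refine mem_of_single_mem
      (S := LinearMap.ker (LinearMap.id + f + f ∘ₗ f + f ∘ₗ f ∘ₗ f + f ∘ₗ f ∘ₗ f ∘ₗ f)) fun j => ?_
    rw [LinearMap.mem_ker]
    exact (fixed_or_orbit_sum_eq_zero hf h5 hroot (formE8_single_self j)).resolve_left (hj j)

/-! ### Isometries satisfying the fifth cyclotomic equation -/

/-- `f` is an isometry of `E₈` with `1 + f + f² + f³ + f⁴ = 0`. -/
structure IsCyclotomicFive (f : (Fin 8 → ℤ) →ₗ[ℤ] (Fin 8 → ℤ)) : Prop where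
  isometry : ∀ x y, formE8 (f x) (f y) = formE8 x y
  sum_eq_zero : ∀ x, x + f x + f (f x) + f (f (f x)) + f (f (f (f x))) = 0

/-- `s` is a root whose products with its `f`-orbit are those of consecutive roots of the extended
Dynkin diagram of type `A₄`. -/
structure IsCyclicRoot (f : (Fin 8 → ℤ) →ₗ[ℤ] (Fin 8 → ℤ)) (s : Fin 8 → ℤ) : Prop where
  root : formE8 s s = 2
  one : formE8 s (f s) = -1
  two : formE8 s (f (f s)) = 0

/-- The products of `s` with the `f`-orbit of `t`. -/
structure OrbitProducts (f : (Fin 8 → ℤ) →ₗ[ℤ] (Fin 8 → ℤ)) (s t : Fin 8 → ℤ)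
    (c₀ c₁ c₂ c₃ c₄ : ℤ) : Prop where
  zero : formE8 s t = c₀
  one : formE8 s (f t) = c₁
  two : formE8 s (f (f t)) = c₂
  three : formE8 s (f (f (f t))) = c₃
  four : formE8 s (f (f (f (f t)))) = c₄

/-- `s` and `t` generate `E₈` under `f`, with a fixed Gram matrix. -/
def IsStandardPair (f : (Fin 8 → ℤ) →ₗ[ℤ] (Fin 8 → ℤ)) (s t : Fin 8 → ℤ) : Prop :=
  IsCyclicRoot f s ∧ IsCyclicRoot f t ∧ OrbitProducts f s t 1 (-1) 0 0 0

theorem IsCyclicRoot.neg {f : (Fin 8 → ℤ) →ₗ[ℤ] (Fin 8 → ℤ)} {t : Fin 8 → ℤ}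
    (ht : IsCyclicRoot f t) : IsCyclicRoot f (-t) := by
  constructor <;> simp [ht.root, ht.one, ht.two]

namespace IsCyclotomicFive

variable {f : (Fin 8 → ℤ) →ₗ[ℤ] (Fin 8 → ℤ)} (hf : IsCyclotomicFive f)

include hf

theorem iterate_five (x : Fin 8 → ℤ) : f (f (f (f (f x)))) = x := by
  have h1 := hf.sum_eq_zero x
  have h2 := hf.sum_eq_zero (f x)
  have : f (f (f (f (f x)))) - x = (f x + f (f x) + f (f (f x)) + f (f (f (f x))) +
    f (f (f (f (f x))))) - (x + f x + f (f x) + f (f (f x)) + f (f (f (f x)))) := by abel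
  rwa [h1, h2, sub_zero, sub_eq_zero] at this

theorem formE8_apply_left (x y : Fin 8 → ℤ) :
    formE8 (f x) y = formE8 x (f (f (f (f y)))) := by
  rw [← hf.isometry x, hf.iterate_five]

theorem orbit_sum_formE8 (s t : Fin 8 → ℤ) : formE8 s t + formE8 s (f t) + formE8 s (f (f t)) +
    formE8 s (f (f (f t))) + formE8 s (f (f (f (f t)))) = 0 := by
  simpa only [map_add, map_zero] using congrArg (formE8 s) (hf.sum_eq_zero t)

theorem formE8_self_three (s : Fin 8 → ℤ) : formE8 s (f (f (f s))) = formE8 s (f (f s)) := by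
  rw [formE8_comm, hf.formE8_apply_left, hf.formE8_apply_left, hf.formE8_apply_left]
  simp only [hf.iterate_five]

theorem formE8_self_four (s : Fin 8 → ℤ) : formE8 s (f (f (f (f s)))) = formE8 s (f s) := by
  rw [← hf.formE8_apply_left, formE8_comm]

/-- The orbit sum relation reads `(r, f r) + (r, f² r) = -1`; the extreme values `±2` would make `r`
zero. -/
theorem root_cases {r : Fin 8 → ℤ} (hr : formE8 r r = 2) :
    IsCyclicRoot f r ∨ (formE8 r (f r) = 0 ∧ formE8 r (f (f r)) = -1) := by
  have hr1 : formE8 (f r) (f r) = 2 := by rw [hf.isometry, hr]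
  have hr2 : formE8 (f (f r)) (f (f r)) = 2 := by rw [hf.isometry, hr1]
  have b1 := formE8_root_root_bounds hr hr1
  have b2 := formE8_root_root_bounds hr hr2
  have hs := hf.orbit_sum_formE8 r r
  rw [hf.formE8_self_three, hf.formE8_self_four, hr] at hs
  have r0 : r ≠ 0 := by rintro rfl; simp at hr
  have m1 : formE8 r (f r) ≠ -2 := fun h => r0 (by
    have e := root_eq_neg_of_formE8_eq_neg_two hr hr1 h
    have := hf.iterate_five r
    simp only [e, map_neg, neg_neg] at this
    exact self_eq_neg.mp this.symm)
  have m2 : formE8 r (f r) ≠ 2 := fun h => r0 (by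
    have e := root_eq_of_formE8_eq_two hr hr1 h
    have h5 := hf.sum_eq_zero r
    simp only [e] at h5
    funext i
    have := congrFun h5 i
    simp at this ⊢
    omega)
  have m3 : formE8 r (f (f r)) ≠ -2 := fun h => by
    have e := root_eq_neg_of_formE8_eq_neg_two hr hr2 h
    have h10 : f (f (f (f (f (f (f (f (f (f r))))))))) = r := by
      rw [hf.iterate_five, hf.iterate_five]
    simp only [e, map_neg, neg_neg] at h10
    exact r0 (self_eq_neg.mp h10.symm)
  by_cases h : formE8 r (f r) = 0
  · exact Or.inr ⟨h, by omega⟩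
  · exact Or.inl ⟨hr, by omega, by omega⟩

/-- The unit `f + f⁻¹` exchanges the two types of root. -/
theorem isCyclicRoot_of_two {r : Fin 8 → ℤ} (hr : formE8 r r = 2) (h1 : formE8 r (f r) = 0)
    (h2 : formE8 r (f (f r)) = -1) : IsCyclicRoot f (f r + f (f (f (f r)))) := by
  have h3 := hf.formE8_self_three r
  have h4 := hf.formE8_self_four r
  constructor <;> simp only [map_add, LinearMap.add_apply, hf.formE8_apply_left,
    hf.iterate_five, hr, h1, h2, h3, h4] <;> norm_num

theorem cyclicRoot_iterate {t : Fin 8 → ℤ} (ht : IsCyclicRoot f t) : IsCyclicRoot f (f t) :=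
  ⟨by rw [hf.isometry, ht.root], by rw [hf.isometry, ht.one], by rw [hf.isometry, ht.two]⟩

theorem orbitProducts_iterate {s t : Fin 8 → ℤ} {c₀ c₁ c₂ c₃ c₄ : ℤ}
    (h : OrbitProducts f s t c₀ c₁ c₂ c₃ c₄) : OrbitProducts f s (f t) c₁ c₂ c₃ c₄ c₀ :=
  ⟨h.one, h.two, h.three, h.four, by rw [hf.iterate_five, h.zero]⟩

end IsCyclotomicFive

theorem OrbitProducts.neg {f : (Fin 8 → ℤ) →ₗ[ℤ] (Fin 8 → ℤ)} {s t : Fin 8 → ℤ}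
    {c₀ c₁ c₂ c₃ c₄ : ℤ} (h : OrbitProducts f s t c₀ c₁ c₂ c₃ c₄) :
    OrbitProducts f s (-t) (-c₀) (-c₁) (-c₂) (-c₃) (-c₄) := by
  constructor <;> simp [h.zero, h.one, h.two, h.three, h.four]

/-- Up to rotation and sign, there are four patterns of five numbers `-1`, `0`, `1` with sum zero and
weighted sum not divisible by `5`. -/
theorem cyclic_pattern_cases {P : ℤ → ℤ → ℤ → ℤ → ℤ → Prop}
    (rot : ∀ a b c d e, P a b c d e → P b c d e a)
    (neg : ∀ a b c d e, P a b c d e → P (-a) (-b) (-c) (-d) (-e))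
    {c₀ c₁ c₂ c₃ c₄ : ℤ} (h : P c₀ c₁ c₂ c₃ c₄) (b₀ : c₀ = -1 ∨ c₀ = 0 ∨ c₀ = 1)
    (b₁ : c₁ = -1 ∨ c₁ = 0 ∨ c₁ = 1) (b₂ : c₂ = -1 ∨ c₂ = 0 ∨ c₂ = 1)
    (b₃ : c₃ = -1 ∨ c₃ = 0 ∨ c₃ = 1) (b₄ : c₄ = -1 ∨ c₄ = 0 ∨ c₄ = 1)
    (hsum : c₀ + c₁ + c₂ + c₃ + c₄ = 0) (h5 : ¬ (5 : ℤ) ∣ c₁ + 2 * c₂ + 3 * c₃ + 4 * c₄) :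
    P 1 (-1) 0 0 0 ∨ P 1 0 (-1) 0 0 ∨ P 0 1 1 (-1) (-1) ∨ P 0 1 (-1) 1 (-1) := by
  have r := fun {a b c d e} => rot a b c d e
  have n := fun {a b c d e} => neg a b c d e
  have close : ∀ {a b c d e}, P a b c d e →
      ((a = 1 ∧ b = -1 ∧ c = 0 ∧ d = 0 ∧ e = 0) ∨ (a = 1 ∧ b = 0 ∧ c = -1 ∧ d = 0 ∧ e = 0) ∨
        (a = 0 ∧ b = 1 ∧ c = 1 ∧ d = -1 ∧ e = -1) ∨ (a = 0 ∧ b = 1 ∧ c = -1 ∧ d = 1 ∧ e = -1)) →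
      P 1 (-1) 0 0 0 ∨ P 1 0 (-1) 0 0 ∨ P 0 1 1 (-1) (-1) ∨ P 0 1 (-1) 1 (-1) := by
    rintro a b c d e h (⟨rfl, rfl, rfl, rfl, rfl⟩ | ⟨rfl, rfl, rfl, rfl, rfl⟩ |
      ⟨rfl, rfl, rfl, rfl, rfl⟩ | ⟨rfl, rfl, rfl, rfl, rfl⟩) <;> simp [h]
  rcases b₀ with rfl | rfl | rfl <;> rcases b₁ with rfl | rfl | rfl <;>
    rcases b₂ with rfl | rfl | rfl <;> rcases b₃ with rfl | rfl | rfl <;>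
    rcases b₄ with rfl | rfl | rfl <;>
    -- Each of the `3⁵` cases violates `hsum` or `h5`, or reaches one of the four patterns by a
    -- rotation and possibly a sign.
    first
    | (exfalso; revert hsum; decide)
    | (exfalso; revert h5; decide)
    | (refine close h ?_; decide)
    | (refine close (r h) ?_; decide)
    | (refine close (r (r h)) ?_; decide)
    | (refine close (r (r (r h))) ?_; decide)
    | (refine close (r (r (r (r h)))) ?_; decide)
    | (refine close (n h) ?_; decide)
    | (refine close (n (r h)) ?_; decide)
    | (refine close (n (r (r h))) ?_; decide)
    | (refine close (n (r (r (r h)))) ?_; decide)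
    | (refine close (n (r (r (r (r h))))) ?_; decide)

namespace IsCyclotomicFive

variable {f : (Fin 8 → ℤ) →ₗ[ℤ] (Fin 8 → ℤ)} (hf : IsCyclotomicFive f)

include hf

theorem orbitProducts_symm {s t : Fin 8 → ℤ} {c₀ c₁ c₂ c₃ c₄ : ℤ}
    (h : OrbitProducts f s t c₀ c₁ c₂ c₃ c₄) : OrbitProducts f t s c₀ c₄ c₃ c₂ c₁ := by
  constructor <;> rw [formE8_comm] <;> simp only [hf.formE8_apply_left, hf.iterate_five, h.zero,
    h.one, h.two, h.three, h.four]

theorem orbitProducts_self {s : Fin 8 → ℤ} (hs : IsCyclicRoot f s) :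
    OrbitProducts f s s 2 (-1) 0 0 (-1) :=
  ⟨hs.root, hs.one, hs.two, by rw [hf.formE8_self_three, hs.two],
    by rw [hf.formE8_self_four, hs.one]⟩

set_option linter.unusedSimpArgs false

theorem not_orbitProducts_plus_zero_minus {s t : Fin 8 → ℤ} (hs : IsCyclicRoot f s)
    (ht : IsCyclicRoot f t) (h : OrbitProducts f s t 1 0 (-1) 0 0) : False := by
  have hs := hf.orbitProducts_self hs
  have ht := hf.orbitProducts_self ht
  have h' := hf.orbitProducts_symm h
  -- The assumed products would give this vector norm `-2`.
  have := formE8_self_nonneg (f (f (f s)) - s - f s + t - f (f t) - f (f (f t)))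
  simp only [map_add, map_sub, LinearMap.add_apply, LinearMap.sub_apply, hf.formE8_apply_left,
    hf.iterate_five, h.zero, h.one, h.two, h.three, h.four, h'.zero, h'.one, h'.two, h'.three,
    h'.four, hs.zero, hs.one, hs.two, hs.three, hs.four, ht.zero, ht.one, ht.two, ht.three,
    ht.four] at this
  norm_num at this

theorem not_orbitProducts_plus_plus_minus_minus {s t : Fin 8 → ℤ} (hs : IsCyclicRoot f s)
    (ht : IsCyclicRoot f t) (h : OrbitProducts f s t 0 1 1 (-1) (-1)) : False := by
  have hs := hf.orbitProducts_self hs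
  have ht := hf.orbitProducts_self ht
  have h' := hf.orbitProducts_symm h
  -- Again the norm would be `-2`.
  have := formE8_self_nonneg (f t + f (f t) - s - f s)
  simp only [map_add, map_sub, LinearMap.add_apply, LinearMap.sub_apply, hf.formE8_apply_left,
    hf.iterate_five, h.zero, h.one, h.two, h.three, h.four, h'.zero, h'.one, h'.two, h'.three,
    h'.four, hs.zero, hs.one, hs.two, hs.three, hs.four, ht.zero, ht.one, ht.two, ht.three,
    ht.four] at this
  norm_num at this

theorem exists_isStandardPair_of_alternating {s t : Fin 8 → ℤ} (hs : IsCyclicRoot f s)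
    (ht : IsCyclicRoot f t) (h : OrbitProducts f s t 0 1 (-1) 1 (-1)) :
    ∃ s t, IsStandardPair f s t := by
  have hs' := hf.orbitProducts_self hs
  have ht := hf.orbitProducts_self ht
  have h' := hf.orbitProducts_symm h
  -- The root `s - f t - f³ t` has products `0, 1, -1, 0, 0` with `s`; the outer `f` rotates them
  -- into standard position.
  refine ⟨s, f (s - f t - f (f (f t))), hs, hf.cyclicRoot_iterate ?_, ?_⟩ <;> constructor <;>
  · simp only [map_add, map_sub, LinearMap.add_apply, LinearMap.sub_apply, hf.formE8_apply_left,
      hf.iterate_five, h.zero, h.one, h.two, h.three, h.four, h'.zero, h'.one, h'.two, h'.three,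
      h'.four, hs'.zero, hs'.one, hs'.two, hs'.three, hs'.four, ht.zero, ht.one, ht.two, ht.three,
      ht.four]
    norm_num

/-- Products `±2` occur only inside one orbit, where the weighted sum of products is divisible
by `5`. -/
theorem orbitProducts_zero_bounds {s t : Fin 8 → ℤ} {c₀ c₁ c₂ c₃ c₄ : ℤ} (hs : IsCyclicRoot f s)
    (ht : IsCyclicRoot f t) (h : OrbitProducts f s t c₀ c₁ c₂ c₃ c₄)
    (h5 : ¬ (5 : ℤ) ∣ c₁ + 2 * c₂ + 3 * c₃ + 4 * c₄) : c₀ = -1 ∨ c₀ = 0 ∨ c₀ = 1 := by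
  have hb := formE8_root_root_bounds hs.root ht.root
  rw [h.zero] at hb
  have hs' := hf.orbitProducts_self hs
  by_cases p : c₀ = 2
  · have e := root_eq_of_formE8_eq_two hs.root ht.root (h.zero.trans p)
    subst e
    rw [← h.one, ← h.two, ← h.three, ← h.four, hs'.one, hs'.two, hs'.three, hs'.four] at h5
    norm_num at h5
  by_cases m : c₀ = -2
  · have e := root_eq_neg_of_formE8_eq_neg_two hs.root ht.root (h.zero.trans m)
    subst e
    rw [← h.one, ← h.two, ← h.three, ← h.four] at h5
    simp only [map_neg, hs'.one, hs'.two, hs'.three, hs'.four] at h5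
    norm_num at h5
  omega

theorem exists_isStandardPair_of_cyclicRoots {s t : Fin 8 → ℤ} {c₀ c₁ c₂ c₃ c₄ : ℤ}
    (hs : IsCyclicRoot f s) (ht : IsCyclicRoot f t) (h : OrbitProducts f s t c₀ c₁ c₂ c₃ c₄)
    (h5 : ¬ (5 : ℤ) ∣ c₁ + 2 * c₂ + 3 * c₃ + 4 * c₄) : ∃ s t, IsStandardPair f s t := by
  have hsum := hf.orbit_sum_formE8 s t
  rw [h.zero, h.one, h.two, h.three, h.four] at hsum
  have ht1 := hf.cyclicRoot_iterate ht
  have ht2 := hf.cyclicRoot_iterate ht1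
  have ht3 := hf.cyclicRoot_iterate ht2
  have ht4 := hf.cyclicRoot_iterate ht3
  have h1 := hf.orbitProducts_iterate h
  have h2 := hf.orbitProducts_iterate h1
  have h3 := hf.orbitProducts_iterate h2
  have h4 := hf.orbitProducts_iterate h3
  have b0 := hf.orbitProducts_zero_bounds hs ht h h5
  have b1 := hf.orbitProducts_zero_bounds hs ht1 h1 (by omega)
  have b2 := hf.orbitProducts_zero_bounds hs ht2 h2 (by omega)
  have b3 := hf.orbitProducts_zero_bounds hs ht3 h3 (by omega)
  have b4 := hf.orbitProducts_zero_bounds hs ht4 h4 (by omega)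
  obtain ⟨t, ht, h⟩ | ⟨t, ht, h⟩ | ⟨t, ht, h⟩ | ⟨t, ht, h⟩ := cyclic_pattern_cases
    (P := fun a b c d e => ∃ t, IsCyclicRoot f t ∧ OrbitProducts f s t a b c d e)
    (fun a b c d e ⟨t, ht, h⟩ => ⟨f t, hf.cyclicRoot_iterate ht, hf.orbitProducts_iterate h⟩)
    (fun a b c d e ⟨t, ht, h⟩ => ⟨-t, ht.neg, h.neg⟩) ⟨t, ht, h⟩ b0 b1 b2 b3 b4 hsum h5
  · exact ⟨s, t, hs, ht, h⟩
  · exact (hf.not_orbitProducts_plus_zero_minus hs ht h).elim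
  · exact (hf.not_orbitProducts_plus_plus_minus_minus hs ht h).elim
  · exact hf.exists_isStandardPair_of_alternating hs ht h

/-- The element `f + 2 f² + 3 f³ + 4 f⁴` is `5 / (f - 1)`, which is not divisible by `5`. -/
theorem exists_not_dvd_single : ∃ j k : Fin 8, ¬ (5 : ℤ) ∣ formE8 (Pi.single j 1)
    (f (Pi.single k 1) + (2 : ℤ) • f (f (Pi.single k 1)) + (3 : ℤ) • f (f (f (Pi.single k 1))) +
      (4 : ℤ) • f (f (f (f (Pi.single k 1))))) := by
  by_contra! hdvd
  let q : (Fin 8 → ℤ) →ₗ[ℤ] (Fin 8 → ℤ) :=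
    f + (2 : ℤ) • f ∘ₗ f + (3 : ℤ) • f ∘ₗ f ∘ₗ f + (4 : ℤ) • f ∘ₗ f ∘ₗ f ∘ₗ f
  have hq : ∀ x, ∃ z, q x = (5 : ℤ) • z := fun x => by
    have := mem_of_single_mem
      (S := (LinearMap.range ((5 : ℤ) • (LinearMap.id : (Fin 8 → ℤ) →ₗ[ℤ] _))).comap q)
      (fun k => by
        obtain ⟨z, hz⟩ := exists_eq_smul_of_dvd_formE8 (m := 5) (x := q (Pi.single k 1)) fun y =>
          mem_of_single_mem
            (S := Submodule.comap (formE8.flip (q (Pi.single k 1))) (Ideal.span {(5 : ℤ)}))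
            (fun j => Ideal.mem_span_singleton.mpr (hdvd j k)) y |>
            Ideal.mem_span_singleton.mp
        exact ⟨z, by simp [hz]⟩) x
    obtain ⟨z, hz⟩ := this
    exact ⟨z, by simpa using hz.symm⟩
  have hdiv : ∀ x, ∃ z, x = f z - z := fun x => by
    obtain ⟨z, hz⟩ := hq x
    refine ⟨z, ?_⟩
    have e := congrArg f hz
    have h5 := hf.iterate_five x
    have hs := hf.sum_eq_zero x
    simp only [q, LinearMap.add_apply, LinearMap.smul_apply, LinearMap.comp_apply, map_add,
      map_smul, h5] at hz e
    -- This is `(f - 1)(f + 2f² + 3f³ + 4f⁴) = 5`.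
    have : (5 : ℤ) • (f z - z) = (5 : ℤ) • x := by
      rw [smul_sub, ← hz, ← e, ← sub_eq_zero]
      have : x = - (f x + f (f x) + f (f (f x)) + f (f (f (f x)))) := by
        rw [eq_neg_iff_add_eq_zero, ← hs]; abel
      generalize f (f (f (f x))) = x4 at *
      generalize f (f (f x)) = x3 at *
      generalize f (f x) = x2 at *
      generalize f x = x1 at *
      rw [this]; module
    exact (smul_right_injective _ (by norm_num : (5 : ℤ) ≠ 0) this).symm
  -- Modulo the cyclotomic relation `(f - 1)⁴ = 5(f² - f³ - f)`, so dividing four times by `f - 1`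
  -- would make a simple root divisible by `5`.
  obtain ⟨a, ha⟩ := hdiv (Pi.single 0 1)
  obtain ⟨b, rfl⟩ := hdiv a
  obtain ⟨c, rfl⟩ := hdiv b
  obtain ⟨d, rfl⟩ := hdiv c
  have hd : Pi.single 0 1 = (5 : ℤ) • (f (f d) - f (f (f d)) - f d) := by
    rw [ha, ← sub_eq_zero, ← hf.sum_eq_zero d]
    simp only [map_sub]
    module
  have := congrFun hd 0
  simp at this
  omega

theorem exists_isStandardPair : ∃ s t, IsStandardPair f s t := by
  obtain ⟨j, k, hjk⟩ := hf.exists_not_dvd_single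
  -- Modulo `5` the weighted sum does not change when `f` is applied to `r`, so replacing `r` by `f
  -- r + f⁴ r` only doubles it.
  have cyc : ∀ (r t : Fin 8 → ℤ), formE8 r r = 2 → ¬ (5 : ℤ) ∣ formE8 r
      (f t + (2 : ℤ) • f (f t) + (3 : ℤ) • f (f (f t)) + (4 : ℤ) • f (f (f (f t)))) →
      ∃ s, IsCyclicRoot f s ∧ ¬ (5 : ℤ) ∣ formE8 s
      (f t + (2 : ℤ) • f (f t) + (3 : ℤ) • f (f (f t)) + (4 : ℤ) • f (f (f (f t)))) := by
    intro r t hr h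
    rcases hf.root_cases hr with hc | ⟨h1, h2⟩
    · exact ⟨r, hc, h⟩
    · refine ⟨_, hf.isCyclicRoot_of_two hr h1 h2, ?_⟩
      have := hf.orbit_sum_formE8 r t
      simp only [map_add, map_smul, LinearMap.add_apply, hf.formE8_apply_left,
        hf.iterate_five, smul_eq_mul] at h ⊢
      omega
  -- Exchanging `r` and `t` turns weight `k` into `5 - k`, so the sum changes sign modulo `5`.
  have flip : ∀ (r t : Fin 8 → ℤ), ¬ (5 : ℤ) ∣ formE8 r
      (f t + (2 : ℤ) • f (f t) + (3 : ℤ) • f (f (f t)) + (4 : ℤ) • f (f (f (f t)))) →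
      ¬ (5 : ℤ) ∣ formE8 t
      (f r + (2 : ℤ) • f (f r) + (3 : ℤ) • f (f (f r)) + (4 : ℤ) • f (f (f (f r)))) := by
    intro r t h
    have := hf.orbit_sum_formE8 r t
    rw [formE8_comm t]
    simp only [map_add, map_smul, LinearMap.add_apply, LinearMap.smul_apply, hf.formE8_apply_left,
      hf.iterate_five, smul_eq_mul] at h ⊢
    omega
  obtain ⟨s, hs, h⟩ := cyc _ _ (formE8_single_self j) hjk
  obtain ⟨t, ht, h⟩ := cyc _ _ (formE8_single_self k) (flip _ _ h)
  have h := flip _ _ h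
  simp only [map_add, map_smul, smul_eq_mul] at h
  exact hf.exists_isStandardPair_of_cyclicRoots hs ht ⟨rfl, rfl, rfl, rfl, rfl⟩ h

end IsCyclotomicFive

/-! ### Conjugacy of the isometries satisfying the fifth cyclotomic equation -/

theorem of_mul_E8_mul_transpose (u : Fin 8 → Fin 8 → ℤ) (i j : Fin 8) :
    (Matrix.of u * (CartanMatrix.E₈ * (Matrix.of u).transpose)) i j = formE8 (u i) (u j) := by
  rw [formE8_eq_dotProduct]; rfl

/-- The first four elements of the orbits of `s` and `t`. -/
def orbitFamily (f : (Fin 8 → ℤ) →ₗ[ℤ] (Fin 8 → ℤ)) (s t : Fin 8 → ℤ) : Fin 8 → Fin 8 → ℤ :=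
  ![s, f s, f (f s), f (f (f s)), t, f t, f (f t), f (f (f t))]

/-- The Gram matrix of the orbits of a standard pair. -/
def standardGram : Matrix (Fin 8) (Fin 8) ℤ :=
  !![2, -1, 0, 0, 1, -1, 0, 0; -1, 2, -1, 0, 0, 1, -1, 0;
    0, -1, 2, -1, 0, 0, 1, -1; 0, 0, -1, 2, 0, 0, 0, 1;
    1, 0, 0, 0, 2, -1, 0, 0; -1, 1, 0, 0, -1, 2, -1, 0;
    0, -1, 1, 0, 0, -1, 2, -1; 0, 0, -1, 1, 0, 0, -1, 2]

theorem isUnit_det_standardGram : IsUnit standardGram.det := by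
  have : standardGram *
      !![2, 2, 1, 0, -1, 0, 1, 1; 2, 4, 3, 1, -2, -2, 0, 1;
        1, 3, 4, 2, -2, -3, -2, 0; 0, 1, 2, 2, -1, -2, -2, -1;
        -1, -2, -2, -1, 2, 2, 1, 0; 0, -2, -3, -2, 2, 4, 3, 1;
        1, 0, -2, -2, 1, 3, 4, 2; 1, 1, 0, -1, 0, 1, 2, 2] = 1 := by decide
  exact IsUnit.of_mul_eq_one _ (by rw [← Matrix.det_mul, this, Matrix.det_one])

theorem formE8_orbitFamily {f : (Fin 8 → ℤ) →ₗ[ℤ] (Fin 8 → ℤ)} (hf : IsCyclotomicFive f)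
    {s t : Fin 8 → ℤ} (h : IsStandardPair f s t) (i j : Fin 8) :
    formE8 (orbitFamily f s t i) (orbitFamily f s t j) = standardGram i j := by
  have hs := hf.orbitProducts_self h.1
  have ht := hf.orbitProducts_self h.2.1
  have h' := hf.orbitProducts_symm h.2.2
  have h := h.2.2
  fin_cases i <;> fin_cases j <;>
    simp [orbitFamily, standardGram, hf.formE8_apply_left, hf.iterate_five, h.zero, h.one, h.two,
      h.three, h.four, h'.zero, h'.one, h'.two, h'.three, h'.four, hs.zero, hs.one, hs.two,
      hs.three, hs.four, ht.zero, ht.one, ht.two, ht.three, ht.four]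

theorem exists_basis_of_isStandardPair {f : (Fin 8 → ℤ) →ₗ[ℤ] (Fin 8 → ℤ)}
    (hf : IsCyclotomicFive f) {s t : Fin 8 → ℤ} (h : IsStandardPair f s t) :
    ∃ b : Module.Basis (Fin 8) ℤ (Fin 8 → ℤ), ⇑b = orbitFamily f s t := by
  have hG : Matrix.of (orbitFamily f s t) *
      (CartanMatrix.E₈ * (Matrix.of (orbitFamily f s t)).transpose) = standardGram := by
    ext i j
    rw [of_mul_E8_mul_transpose, formE8_orbitFamily hf h]
  have hu : IsUnit ((Pi.basisFun ℤ (Fin 8)).det (orbitFamily f s t)) := by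
    rw [Pi.basisFun_det_apply]
    have := isUnit_det_standardGram
    rw [← hG, Matrix.det_mul] at this
    exact isUnit_of_mul_isUnit_left this
  have := (Module.Basis.is_basis_iff_det (Pi.basisFun ℤ (Fin 8))).mpr hu
  exact ⟨Module.Basis.mk this.1 this.2.ge, Module.Basis.coe_mk _ _⟩

theorem IsCyclotomicFive.isConj {h g : orthogonalGroup formE8}
    (hh : IsCyclotomicFive h.1.toLinearMap) (hg : IsCyclotomicFive g.1.toLinearMap) :
    IsConj h g := by
  obtain ⟨s, t, hst⟩ := hh.exists_isStandardPair
  obtain ⟨s', t', hst'⟩ := hg.exists_isStandardPair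
  obtain ⟨b, hb⟩ := exists_basis_of_isStandardPair hh hst
  obtain ⟨b', hb'⟩ := exists_basis_of_isStandardPair hg hst'
  let φ : (Fin 8 → ℤ) ≃ₗ[ℤ] (Fin 8 → ℤ) := b.equiv b' (Equiv.refl _)
  have hφ : ∀ i, φ (orbitFamily h.1.toLinearMap s t i) = orbitFamily g.1.toLinearMap s' t' i := by
    intro i
    rw [← hb, ← hb', Module.Basis.equiv_apply, Equiv.refl_apply]
  have hiso : φ ∈ orthogonalGroup formE8 := by
    have : formE8.comp φ.toLinearMap φ.toLinearMap = formE8 := by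
      refine LinearMap.BilinForm.ext_basis b fun i j => ?_
      rw [hb, LinearMap.BilinForm.comp_apply]
      change formE8 (φ _) (φ _) = _
      rw [hφ, hφ, formE8_orbitFamily hg hst', formE8_orbitFamily hh hst]
    intro x y
    exact DFunLike.congr_fun (DFunLike.congr_fun this x) y
  have hcomm : φ.toLinearMap ∘ₗ h.1.toLinearMap = g.1.toLinearMap ∘ₗ φ.toLinearMap := by
    refine b.ext fun i => ?_
    rw [hb]
    change φ (h.1 _) = g.1 (φ _)
    rw [hφ]
    have e0 : φ s = s' := hφ 0
    have e1 : φ (h.1 s) = g.1 s' := hφ 1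
    have e2 : φ (h.1 (h.1 s)) = g.1 (g.1 s') := hφ 2
    have e3 : φ (h.1 (h.1 (h.1 s))) = g.1 (g.1 (g.1 s')) := hφ 3
    have d0 : φ t = t' := hφ 4
    have d1 : φ (h.1 t) = g.1 t' := hφ 5
    have d2 : φ (h.1 (h.1 t)) = g.1 (g.1 t') := hφ 6
    have d3 : φ (h.1 (h.1 (h.1 t))) = g.1 (g.1 (g.1 t')) := hφ 7
    -- The fourth power is not in the basis; the cyclotomic relation expresses it by the lower ones
    -- on both sides.
    have last : ∀ x y, φ x = y → φ (h.1 x) = g.1 y → φ (h.1 (h.1 x)) = g.1 (g.1 y) →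
        φ (h.1 (h.1 (h.1 x))) = g.1 (g.1 (g.1 y)) →
        φ (h.1 (h.1 (h.1 (h.1 x)))) = g.1 (g.1 (g.1 (g.1 y))) := by
      intro x y k0 k1 k2 k3
      have a1 := congrArg φ (hh.sum_eq_zero x)
      have a2 := hg.sum_eq_zero y
      simp only [LinearEquiv.coe_coe, map_add, map_zero, k0, k1, k2, k3] at a1 a2
      exact add_left_cancel (a1.trans a2.symm)
    fin_cases i
    · exact e1
    · exact e2
    · exact e3
    · exact last s s' e0 e1 e2 e3
    · exact d1
    · exact d2
    · exact d3
    · exact last t t' d0 d1 d2 d3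
  rw [isConj_iff]
  refine ⟨⟨φ, hiso⟩, ?_⟩
  rw [mul_inv_eq_iff_eq_mul]
  ext1
  ext1 x
  exact LinearMap.congr_fun hcomm x

/-! ### Extending pairs of cycles from `A₄ ⊥ A₄` to `E₈` -/

theorem formA_apply {n : ℕ} (a b : latticeA n) : formA n a b = ∑ k, a.1 k * b.1 k := rfl

theorem coe_permA_apply {n : ℕ} (σ : Equiv.Perm (Fin (n + 1))) (a : latticeA n) (k : Fin (n + 1)) :
    ((permA σ).1 a).1 k = a.1 (σ.symm k) := rfl

/-- The vector `e_k - e_0` of `A_n`. -/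
def differenceA {n : ℕ} (k : Fin (n + 1)) : latticeA n :=
  ⟨Pi.single k 1 - Pi.single 0 1, by
    change ∑ l, (Pi.single k 1 - Pi.single 0 1 : Fin (n + 1) → ℤ) l = 0
    simp⟩

theorem sum_smul_differenceA {n : ℕ} (a : latticeA n) : ∑ k, a.1 k • differenceA k = a := by
  have ha : ∑ k, a.1 k = 0 := a.2
  ext l
  simp [differenceA, mul_sub, Finset.sum_sub_distrib, ha, Pi.single_apply]

/-- The map `v ↦ σ v - v` from `ℤⁿ⁺¹` to `A_n`. -/
def permSubId {n : ℕ} (σ : Equiv.Perm (Fin (n + 1))) : (Fin (n + 1) → ℤ) →ₗ[ℤ] latticeA n where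
  toFun v := ⟨v ∘ σ.symm - v, by
    change ∑ l, (v ∘ σ.symm - v) l = 0
    simp [Finset.sum_sub_distrib, Equiv.sum_comp σ.symm v]⟩
  map_add' v w := by ext l; simp; ring
  map_smul' c v := by ext l; simp; ring

/-- The products of a vector of `E₈` with the vectors `e_k - e_0` of an `A_n` sublattice. -/
def dualVector {n : ℕ} (j : formA n →bᵢ formE8) : (Fin 8 → ℤ) →ₗ[ℤ] (Fin (n + 1) → ℤ) :=
  LinearMap.pi fun k => formE8.flip (j (differenceA k))

theorem formE8_eq_sum_dualVector {n : ℕ} (j : formA n →bᵢ formE8) (x : Fin 8 → ℤ)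
    (a : latticeA n) : formE8 x (j a) = ∑ k, dualVector j x k * a.1 k := by
  conv_lhs => rw [← sum_smul_differenceA a]
  simp only [map_sum, map_smul, smul_eq_mul]
  exact Finset.sum_congr rfl fun k _ => mul_comm _ _

theorem sum_dualVector_mul {n : ℕ} (j : formA n →bᵢ formE8) (a b : latticeA n) :
    ∑ k, dualVector j (j a) k * b.1 k = ∑ k, a.1 k * b.1 k := by
  rw [← formE8_eq_sum_dualVector, j.map_app, formA_apply]

/-- A permutation of the coordinates of a sublattice of type `A_n` extends to an isometry of `E₈` that
is trivial on the orthogonal complement. -/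
def extendPerm {n : ℕ} (j : formA n →bᵢ formE8) (σ : Equiv.Perm (Fin (n + 1))) :
    (Fin 8 → ℤ) →ₗ[ℤ] (Fin 8 → ℤ) :=
  -- The dual vector represents the projection of `x` to the span of `A_n`, up to constant vectors.
  -- It need not lie in `A_n`, but `σ v - v` does, which keeps the map integral.
  LinearMap.id + j.toLinearMap ∘ₗ permSubId σ ∘ₗ dualVector j

theorem extendPerm_apply {n : ℕ} (j : formA n →bᵢ formE8) (σ : Equiv.Perm (Fin (n + 1)))
    (x : Fin 8 → ℤ) : extendPerm j σ x = x + j (permSubId σ (dualVector j x)) := rfl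

/-- For dual vectors `v`, `w` of `x`, `y`, the correction is `v·(σw - w) + w·(σv - v) + (σv - v)·(σw
- w)`, which vanishes because `σv·σw = v·w`. -/
theorem formE8_extendPerm {n : ℕ} (j : formA n →bᵢ formE8) (σ : Equiv.Perm (Fin (n + 1)))
    (x y : Fin 8 → ℤ) : formE8 (extendPerm j σ x) (extendPerm j σ y) = formE8 x y := by
  simp only [extendPerm_apply, map_add, LinearMap.add_apply]
  rw [formE8_comm (j _) y, j.map_app, formE8_eq_sum_dualVector, formE8_eq_sum_dualVector,
    formA_apply]
  have h1 : ∀ v w : Fin (n + 1) → ℤ, ∑ k, v k * (permSubId σ w).1 k =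
      ∑ k, v k * w (σ.symm k) - ∑ k, v k * w k := fun v w => by
    rw [← Finset.sum_sub_distrib]
    exact Finset.sum_congr rfl fun k _ => mul_sub _ _ _
  have h2 : ∀ v w : Fin (n + 1) → ℤ, ∑ k, v (σ.symm k) * w (σ.symm k) = ∑ k, v k * w k :=
    fun v w => Equiv.sum_comp σ.symm fun k => v k * w k
  have h3 : ∀ v w : Fin (n + 1) → ℤ, ∑ k, (permSubId σ v).1 k * (permSubId σ w).1 k =
      ∑ k, v (σ.symm k) * (permSubId σ w).1 k - ∑ k, v k * (permSubId σ w).1 k := fun v w => by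
    rw [← Finset.sum_sub_distrib]
    exact Finset.sum_congr rfl fun k _ => sub_mul _ _ _
  have h4 := h1 (dualVector j x ∘ σ.symm) (dualVector j y)
  simp only [Function.comp_apply] at h4
  rw [h3, h4, h1, h1, h2]
  have h5 : ∑ k, dualVector j y k * dualVector j x (σ.symm k) =
      ∑ k, dualVector j x (σ.symm k) * dualVector j y k :=
    Finset.sum_congr rfl fun k _ => mul_comm _ _
  have h6 : ∑ k, dualVector j y k * dualVector j x k = ∑ k, dualVector j x k * dualVector j y k :=
    Finset.sum_congr rfl fun k _ => mul_comm _ _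
  rw [h5, h6]
  ring

theorem extendPerm_map {n : ℕ} (j : formA n →bᵢ formE8) (σ : Equiv.Perm (Fin (n + 1)))
    (a : latticeA n) : extendPerm j σ (j a) = j ((permA σ).1 a) := by
  have key : permSubId σ (dualVector j (j a)) = (permA σ).1 a - a := by
    -- The dual vector of `j a` differs from `a` by a constant vector, which `permSubId` kills.
    have hc : ∀ k, dualVector j (j a) k = a.1 k - a.1 0 := fun k => by
      have := sum_dualVector_mul j a (differenceA k)
      have e0 : dualVector j (j a) 0 = 0 := by
        have : (differenceA 0 : latticeA n) = 0 := by ext; simp [differenceA]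
        simp [dualVector, this]
      simpa [differenceA, mul_sub, Finset.sum_sub_distrib, Pi.single_apply, e0] using this
    ext k
    change dualVector j (j a) (σ.symm k) - dualVector j (j a) k = a.1 (σ.symm k) - a.1 k
    rw [hc, hc]
    ring
  rw [extendPerm_apply, key, map_sub, add_sub_cancel]

theorem extendPerm_eq_self {n : ℕ} (j : formA n →bᵢ formE8) (σ : Equiv.Perm (Fin (n + 1)))
    {x : Fin 8 → ℤ} (hx : ∀ a, formE8 x (j a) = 0) : extendPerm j σ x = x := by
  have : dualVector j x = 0 := funext fun k => hx _
  rw [extendPerm_apply, this, map_zero, map_zero, add_zero]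

theorem permA_iterate_five {σ : Equiv.Perm (Fin 5)} (hσ : IsFullCycle σ) (a : latticeA 4) :
    (permA σ).1 ((permA σ).1 ((permA σ).1 ((permA σ).1 ((permA σ).1 a)))) = a := by
  have h5 : σ⁻¹ ^ 5 = 1 := by
    have h := hσ.1.orderOf
    rw [hσ.2] at h
    rw [inv_pow, inv_eq_one]
    exact orderOf_dvd_iff_pow_eq_one.mp h.dvd
  ext k
  change a.1 ((σ⁻¹ ^ 5) k) = a.1 k
  rw [h5, Equiv.Perm.one_apply]

/-- The orbit sum is invariant under a transitive cycle, hence constant, and its coordinate sum is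
`0`. -/
theorem permA_orbit_sum {σ : Equiv.Perm (Fin 5)} (hσ : IsFullCycle σ) (a : latticeA 4) :
    a + (permA σ).1 a + (permA σ).1 ((permA σ).1 a) + (permA σ).1 ((permA σ).1 ((permA σ).1 a)) +
      (permA σ).1 ((permA σ).1 ((permA σ).1 ((permA σ).1 a))) = 0 := by
  set w := a + (permA σ).1 a + (permA σ).1 ((permA σ).1 a) +
    (permA σ).1 ((permA σ).1 ((permA σ).1 a)) +
      (permA σ).1 ((permA σ).1 ((permA σ).1 ((permA σ).1 a))) with hw
  have hfix : (permA σ).1 w = w := by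
    rw [hw]
    simp only [map_add, permA_iterate_five hσ]
    abel
  have hinv : ∀ k, w.1 (σ k) = w.1 k := fun k => by
    have := congrArg (fun b : latticeA 4 => b.1 (σ k)) hfix
    simpa [coe_permA_apply] using this.symm
  have hpow : ∀ (m : ℕ) k, w.1 ((σ ^ m) k) = w.1 k := fun m => by
    induction m with
    | zero => simp
    | succ m ih => intro k; rw [pow_succ', Equiv.Perm.mul_apply, hinv, ih]
  have hconst : ∀ k, w.1 k = w.1 0 := fun k => by
    have hm : ∀ k, σ k ≠ k := fun k => Equiv.Perm.mem_support.mp (hσ.2 ▸ Finset.mem_univ k)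
    obtain ⟨m, hm⟩ := (hσ.1.exists_pow_eq (hm 0) (hm k))
    rw [← hm, hpow]
  have hsum : ∑ k, w.1 k = 0 := w.2
  rw [Finset.sum_congr rfl fun k _ => hconst k] at hsum
  have h0 : w.1 0 = 0 := by simpa using hsum
  ext k
  rw [hconst, h0]
  rfl

/-- The simple roots of `A₄ ⊥ A₄`. -/
def simpleRootsA4A4 : Fin 8 → latticeA 4 × latticeA 4 :=
  ![(differenceA 1 , 0), (differenceA 2 - differenceA 1, 0),
    (differenceA 3 - differenceA 2, 0), (differenceA 4 - differenceA 3, 0),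
    (0, differenceA 1), (0, differenceA 2 - differenceA 1),
    (0, differenceA 3 - differenceA 2), (0, differenceA 4 - differenceA 3)]

/-- A sublattice `A₄ ⊥ A₄` has finite index in `E₈`, so its orthogonal complement vanishes. -/
theorem eq_zero_of_orthogonal (i : sumForm (formA 4) (formA 4) →bᵢ formE8) {w : Fin 8 → ℤ}
    (hw : ∀ a, formE8 (i a) w = 0) : w = 0 := by
  let U : Matrix (Fin 8) (Fin 8) ℤ := Matrix.of fun k => i (simpleRootsA4A4 k)
  have hG : U * (CartanMatrix.E₈ * U.transpose) =
      !![2, -1, 0, 0, 0, 0, 0, 0; -1, 2, -1, 0, 0, 0, 0, 0; 0, -1, 2, -1, 0, 0, 0, 0;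
        0, 0, -1, 2, 0, 0, 0, 0; 0, 0, 0, 0, 2, -1, 0, 0; 0, 0, 0, 0, -1, 2, -1, 0;
        0, 0, 0, 0, 0, -1, 2, -1; 0, 0, 0, 0, 0, 0, -1, 2] := by
    ext k l
    rw [of_mul_E8_mul_transpose, i.map_app]
    fin_cases k <;> fin_cases l <;> rfl
  have hdet : U.det ≠ 0 := by
    intro h0
    have h1 := congrArg Matrix.det hG
    rw [Matrix.det_mul, h0, zero_mul] at h1
    -- The second factor is `5` times the inverse of the Gram matrix, so the latter is nonsingular.
    have h2 := congrArg Matrix.det (show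
      (!![2, -1, 0, 0, 0, 0, 0, 0; -1, 2, -1, 0, 0, 0, 0, 0; 0, -1, 2, -1, 0, 0, 0, 0;
        0, 0, -1, 2, 0, 0, 0, 0; 0, 0, 0, 0, 2, -1, 0, 0; 0, 0, 0, 0, -1, 2, -1, 0;
        0, 0, 0, 0, 0, -1, 2, -1; 0, 0, 0, 0, 0, 0, -1, 2] : Matrix (Fin 8) (Fin 8) ℤ) *
      !![4, 3, 2, 1, 0, 0, 0, 0; 3, 6, 4, 2, 0, 0, 0, 0; 2, 4, 6, 3, 0, 0, 0, 0;
        1, 2, 3, 4, 0, 0, 0, 0; 0, 0, 0, 0, 4, 3, 2, 1; 0, 0, 0, 0, 3, 6, 4, 2;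
        0, 0, 0, 0, 2, 4, 6, 3; 0, 0, 0, 0, 1, 2, 3, 4] = (5 : ℤ) • 1 by decide)
    rw [Matrix.det_mul, ← h1, zero_mul, Matrix.det_smul, Matrix.det_one] at h2
    norm_num at h2
  have hC : CartanMatrix.E₈.mulVec w = 0 := by
    refine Matrix.eq_zero_of_mulVec_eq_zero hdet (funext fun k => ?_)
    exact (formE8_eq_dotProduct _ _).symm.trans (hw _)
  exact Matrix.eq_zero_of_mulVec_eq_zero (by rw [CartanMatrix.E₈_det]; exact one_ne_zero) hC

theorem exists_extends (i : sumForm (formA 4) (formA 4) →bᵢ formE8) {σ τ : Equiv.Perm (Fin 5)}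
    (hσ : IsFullCycle σ) (hτ : IsFullCycle τ) :
    ∃ g : orthogonalGroup formE8, Extends i g (directSum (permA σ) (permA τ)) ∧
      IsCyclotomicFive g.1.toLinearMap := by
  let j₁ : formA 4 →bᵢ formE8 :=
    { toLinearMap := i.toLinearMap ∘ₗ LinearMap.inl ℤ _ _
      map_app' := fun a b => (i.map_app (a, 0) (b, 0)).trans (by simp [sumForm]) }
  let j₂ : formA 4 →bᵢ formE8 :=
    { toLinearMap := i.toLinearMap ∘ₗ LinearMap.inr ℤ _ _
      map_app' := fun a b => (i.map_app (0, a) (0, b)).trans (by simp [sumForm]) }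
  have hj : ∀ a b, i (a, b) = j₁ a + j₂ b := fun a b => by
    change i (a, b) = i (a, 0) + i (0, b)
    rw [← map_add]; simp
  have horth : ∀ a b, formE8 (j₁ a) (j₂ b) = 0 := fun a b =>
    (i.map_app (a, 0) (0, b)).trans (by simp [sumForm])
  let f : (Fin 8 → ℤ) →ₗ[ℤ] (Fin 8 → ℤ) := extendPerm j₁ σ ∘ₗ extendPerm j₂ τ
  have hiso : ∀ x y, formE8 (f x) (f y) = formE8 x y := fun x y => by
    simp only [f, LinearMap.comp_apply, formE8_extendPerm]
  have hext : ∀ a : latticeA 4 × latticeA 4,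
      f (i a) = i ((directSum (permA σ) (permA τ)).1 a) := fun ⟨a, b⟩ => by
    change extendPerm j₁ σ (extendPerm j₂ τ (i (a, b))) = i ((permA σ).1 a, (permA τ).1 b)
    rw [hj, hj, map_add, extendPerm_map, extendPerm_eq_self j₂ τ (horth a), map_add,
      extendPerm_map, extendPerm_eq_self j₁ σ]
    intro c
    rw [formE8_comm, horth]
  have hcyc : IsCyclotomicFive f := by
    -- Since `(i a, fᵏ x) = (i (p⁵⁻ᵏ a), x)`, the orbit sum moves to the left argument, where it
    -- vanishes.
    refine ⟨hiso, fun x => eq_zero_of_orthogonal i fun a => ?_⟩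
    let p := (directSum (permA σ) (permA τ)).1
    have hp5 : p (p (p (p (p a)))) = a :=
      Prod.ext (permA_iterate_five hσ a.1) (permA_iterate_five hτ a.2)
    have hpsum : p a + p (p a) + p (p (p a)) + p (p (p (p a))) + p (p (p (p (p a)))) = 0 := by
      refine Prod.ext ?_ ?_
      · exact permA_orbit_sum hσ ((permA σ).1 a.1)
      · exact permA_orbit_sum hτ ((permA τ).1 a.2)
    have hext' : ∀ b, f (i b) = i (p b) := hext
    have k0 : formE8 (i a) x = formE8 (i (p (p (p (p (p a)))))) x := by rw [hp5]
    have k1 : formE8 (i a) (f x) = formE8 (i (p (p (p (p a))))) x := by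
      conv_lhs => rw [← hp5]
      rw [← hext', hiso]
    have k2 : formE8 (i a) (f (f x)) = formE8 (i (p (p (p a)))) x := by
      conv_lhs => rw [← hp5]
      rw [← hext', hiso, ← hext', hiso]
    have k3 : formE8 (i a) (f (f (f x))) = formE8 (i (p (p a))) x := by
      conv_lhs => rw [← hp5]
      rw [← hext', hiso, ← hext', hiso, ← hext', hiso]
    have k4 : formE8 (i a) (f (f (f (f x)))) = formE8 (i (p a)) x := by
      conv_lhs => rw [← hp5]
      rw [← hext', hiso, ← hext', hiso, ← hext', hiso, ← hext', hiso]
    have := congrArg (fun b => formE8 (i b) x) hpsum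
    simp only [map_add, map_zero, LinearMap.add_apply, LinearMap.zero_apply] at this
    simp only [map_add, k0, k1, k2, k3, k4]
    linarith
  clear_value f
  let e : (Fin 8 → ℤ) ≃ₗ[ℤ] (Fin 8 → ℤ) := LinearEquiv.ofLinearMap f (f ∘ₗ f ∘ₗ f ∘ₗ f)
    (LinearMap.ext hcyc.iterate_five) (LinearMap.ext hcyc.iterate_five)
  have he : ∀ x, e x = f x := fun _ => rfl
  refine ⟨⟨e, fun x y => ?_⟩, fun a => ?_, hcyc⟩
  · rw [he, he, hiso]
  · exact (he _).trans (hext a)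

/-- Removing a node from the extended Dynkin diagram of `E₈` leaves a sublattice `A₄ ⊥ A₄`. -/
def embeddingA4A4 : sumForm (formA 4) (formA 4) →bᵢ formE8 where
  toFun x :=
    -- Partial sums are the coefficients on the roots `e_k - e_{k+1}`. The first copy goes to the
    -- chain of nodes `0, 2, 3, 1`, the second to `5, 6, 7` followed by minus the highest root `(2,
    -- 3, 4, 6, 5, 4, 3, 2)`; the removed node is `4`.
    let p (k : Fin 5) := ∑ l ≤ k, x.1.1 l
    let q (k : Fin 5) := ∑ l ≤ k, x.2.1 l
    ![p 0 - 2 * q 3, p 3 - 3 * q 3, p 1 - 4 * q 3, p 2 - 6 * q 3, -5 * q 3, q 0 - 4 * q 3,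
      q 1 - 3 * q 3, q 2 - 2 * q 3]
  map_add' x y := by
    ext k
    fin_cases k <;> simp [Finset.sum_add_distrib] <;> ring
  map_smul' c x := by
    ext k
    fin_cases k <;> simp [← Finset.mul_sum] <;> ring
  map_app' x y := by
    obtain ⟨⟨a, ha⟩, ⟨b, hb⟩⟩ := x
    obtain ⟨⟨c, hc⟩, ⟨d, hd⟩⟩ := y
    change _ = formA 4 ⟨a, ha⟩ ⟨c, hc⟩ + formA 4 ⟨b, hb⟩ ⟨d, hd⟩
    have s0 : ∀ v : Fin 5 → ℤ, ∑ l ≤ (0 : Fin 5), v l = v 0 := fun v => by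
      rw [show Finset.Iic (0 : Fin 5) = {0} by decide]; simp
    have s1 : ∀ v : Fin 5 → ℤ, ∑ l ≤ (1 : Fin 5), v l = v 0 + v 1 := fun v => by
      rw [show Finset.Iic (1 : Fin 5) = {0, 1} by decide]; simp
    have s2 : ∀ v : Fin 5 → ℤ, ∑ l ≤ (2 : Fin 5), v l = v 0 + v 1 + v 2 := fun v => by
      rw [show Finset.Iic (2 : Fin 5) = {0, 1, 2} by decide]; simp; ring
    have s3 : ∀ v : Fin 5 → ℤ, ∑ l ≤ (3 : Fin 5), v l = v 0 + v 1 + v 2 + v 3 := fun v => by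
      rw [show Finset.Iic (3 : Fin 5) = {0, 1, 2, 3} by decide]; simp; ring
    have last : ∀ v : Fin 5 → ℤ, v ∈ latticeA 4 → v 4 = -(v 0 + v 1 + v 2 + v 3) := fun v hv => by
      have : ∑ k, v k = 0 := hv
      rw [Fin.sum_univ_five] at this
      omega
    rw [formE8_apply, formA_apply, formA_apply]
    simp [s0, s1, s2, s3, Fin.sum_univ_five, last a ha, last b hb, last c hc, last d hd]
    ring

end Rootless

theorem theorem4p2 (h : Rootless.orthogonalGroup Rootless.formE8)
    (h_rootless : Rootless.IsRootless h) (h_order : orderOf h = 5) :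
    Rootless.IsFixedPointFree h ∧
    -- there is an `A₄ ⊥ A₄` sublattice in `E₈`, and for each of them and any two 5-cycles
    Nonempty (Rootless.sumForm (Rootless.formA 4) (Rootless.formA 4) →bᵢ Rootless.formE8) ∧
    ∀ (i : Rootless.sumForm (Rootless.formA 4) (Rootless.formA 4) →bᵢ Rootless.formE8)
      (σ τ : Equiv.Perm (Fin 5)), Rootless.IsFullCycle σ → Rootless.IsFullCycle τ →
      ∃ g : Rootless.orthogonalGroup Rootless.formE8,
        Rootless.Extends i g (Rootless.directSum (Rootless.permA σ) (Rootless.permA τ)) ∧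
        IsConj h g := by
  have h5 : ∀ x, h.1 (h.1 (h.1 (h.1 (h.1 x)))) = x := fun x => by
    have : h ^ 5 = 1 := h_order ▸ pow_orderOf_eq_one h
    exact congrArg (fun g : Rootless.orthogonalGroup Rootless.formE8 => g.1 x) this
  have hsum : ∀ x, x + h.1 x + h.1 (h.1 x) + h.1 (h.1 (h.1 x)) + h.1 (h.1 (h.1 (h.1 x))) = 0 := by
    refine (Rootless.eq_id_or_orbit_sum_eq_zero (f := h.1.toLinearMap) h.2 h5
      h_rootless).resolve_left fun hid => ?_
    have : h = 1 := Subtype.ext (LinearEquiv.ext hid)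
    rw [this, orderOf_one] at h_order
    norm_num at h_order
  have hcyc : Rootless.IsCyclotomicFive h.1.toLinearMap := ⟨h.2, hsum⟩
  refine ⟨fun x hx => ?_, ⟨Rootless.embeddingA4A4⟩, fun i σ τ hσ hτ => ?_⟩
  · have := hsum x
    simp only [hx] at this
    ext k
    have := congrFun this k
    simp only [Pi.add_apply, Pi.zero_apply] at this ⊢
    omega
  · obtain ⟨g, hext, hg⟩ := Rootless.exists_extends i hσ hτ
    exact ⟨g, hext, hcyc.isConj hg⟩
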